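/- Work over the field $\mathbb{Q}$. For $n\in\mathbb{N}$ let \[ \mathrm{Cut}^2_n\bigl((x_{i,j})_{i,j\in[n]}\bigr)\;=\;\sum_{V\subseteq[n]}\ \prod_{v\in V}\ \prod_{v'\in [n]\setminus V} x_{v,v'}\ \in\ \mathbb{Q}[x_{i,j}: i,j\in[n]], \] where the $n^2$ variables $x_{i,j}$ are independent ($x_{i,j}$ and $x_{j,i}$ are different variables for $i\neq j$). Then the family $(\mathrm{Cut}^2_n)_{n}$ is $\mathsf{VNP}$-complete for c-reductions; that is, $(\mathrm{Cut}^2_n)\in\mathsf{VNP}$, and every family $(f_n)\in\mathsf{VNP}$ over $\mathbb{Q}$ c-reduces to $(\mathrm{Cut}^2_n)$. Here the following standard notions are used. The complexity $L(f)$ of a polynomial $f$ is the minimal number of computation gates (additions and multiplications of fan-in $2$) of an arithmetic circuit computing $f$ from variables and constants of $\mathbb{Q}$. A p-family is a sequence $(f_n)$ of polynomials whose number of variables and degree are polynomially bounded in $n$. $\mathsf{VP}$ is the class of p-families $(f_n)$ with $L(f_n)$ polynomially bounded in $n$. A p-family $(f_n)$ is in $\mathsf{VNP}$ if there are a function $m:\mathbb{N}\to\mathbb{N}$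 and a family $(g_n)\in\mathsf{VP}$ such that $f_n(\bar x)=\sum_{\bar\varepsilon\in\{0,1\}^{m(n)}} g_n(\bar x,\bar\varepsilon)$ for all $n$. The oracle complexity $L^{g}(f)$ is the minimal number of computation gates and evaluations of $g$ at previously computed values (including variables and constants) that suffice to compute $f$ from variables and constants. A family $(f_n)$ c-reduces to $(g_n)$ if there is a polynomially bounded $p:\mathbb{N}\to\mathbb{N}$ such that $L^{g_{p(n)}}(f_n)$ is polynomially bounded in $n$. -/

import Mathlib

namespace Valiant

/-- `t` is bounded by a polynomial in `n`. -/
def PolyBounded (t : ℕ → ℕ) : Prop :=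
  ∃ p : Polynomial ℕ, ∀ n, t n ≤ p.eval n

/-- An argument of a gate: a constant of `K`, a variable, or one of the `k` gates that
precede it. -/
inductive Operand (K σ : Type*) (k : ℕ)
  | const (c : K)
  | var (i : σ)
  | gate (j : Fin k)

/-- The polynomial denoted by an operand, if `w` lists the values of the preceding gates. -/
noncomputable def Operand.val {K σ : Type*} [CommSemiring K] {k : ℕ}
    (w : Fin k → MvPolynomial σ K) : Operand K σ k → MvPolynomial σ K
  | .const c => MvPolynomial.C c
  | .var i => MvPolynomial.X i
  | .gate j => w j

/-- Arithmetic circuits with `k` computation gates, each of them an addition or a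
multiplication of fan-in two. The computation gates of the directed acyclic graph are listed in
a topological order; the input gates (constants and variables) are not counted and appear as
operands. The value of a gate may be used any number of times. -/
inductive Circuit (K σ : Type*) : ℕ → Type _
  | nil : Circuit K σ 0
  | add {k : ℕ} (D : Circuit K σ k) (a b : Operand K σ k) : Circuit K σ (k + 1)
  | mul {k : ℕ} (D : Circuit K σ k) (a b : Operand K σ k) : Circuit K σ (k + 1)

/-- The polynomials computed by the computation gates of a circuit. -/
noncomputable def Circuit.values {K σ : Type*} [CommSemiring K] :
    {k : ℕ} → Circuit K σ k → Fin k → MvPolynomial σ K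
  | _, .nil => Fin.elim0
  | _, .add D a b =>
      Fin.snoc (α := fun _ => MvPolynomial σ K) D.values (a.val D.values + b.val D.values)
  | _, .mul D a b =>
      Fin.snoc (α := fun _ => MvPolynomial σ K) D.values (a.val D.values * b.val D.values)

/-- `L(f) ≤ s`: some arithmetic circuit with at most `s` computation gates has an output
(a gate, or merely a variable or a constant) that computes `f`. -/
def ComplexityLE {K σ : Type*} [CommSemiring K] (f : MvPolynomial σ K) (s : ℕ) : Prop :=
  ∃ k ≤ s, ∃ (D : Circuit K σ k) (out : Operand K σ k), out.val D.values = f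

/-- Arithmetic circuits in the variables `σ` that also have oracle gates. An oracle gate
evaluates an oracle polynomial in the variables `τ` at values that are already available, and
counts as one gate. -/
inductive OracleCircuit (K σ τ : Type*) : ℕ → Type _
  | nil : OracleCircuit K σ τ 0
  | add {k : ℕ} (D : OracleCircuit K σ τ k) (a b : Operand K σ k) : OracleCircuit K σ τ (k + 1)
  | mul {k : ℕ} (D : OracleCircuit K σ τ k) (a b : Operand K σ k) : OracleCircuit K σ τ (k + 1)
  | oracle {k : ℕ} (D : OracleCircuit K σ τ k) (a : τ → Operand K σ k) :
      OracleCircuit K σ τ (k + 1)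

/-- The polynomials computed by the gates of an oracle circuit, if the oracle is `g`. -/
noncomputable def OracleCircuit.values {K σ τ : Type*} [CommSemiring K] (g : MvPolynomial τ K) :
    {k : ℕ} → OracleCircuit K σ τ k → Fin k → MvPolynomial σ K
  | _, .nil => Fin.elim0
  | _, .add D a b =>
      Fin.snoc (α := fun _ => MvPolynomial σ K) (D.values g)
        (a.val (D.values g) + b.val (D.values g))
  | _, .mul D a b =>
      Fin.snoc (α := fun _ => MvPolynomial σ K) (D.values g)
        (a.val (D.values g) * b.val (D.values g))
  | _, .oracle D a =>
      Fin.snoc (α := fun _ => MvPolynomial σ K) (D.values g)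
        (MvPolynomial.aeval (fun t => (a t).val (D.values g)) g)

/-- `L^g(f) ≤ s`: at most `s` computation gates and evaluations of `g` at previously computed
values suffice to compute `f` from variables and constants. -/
def OracleComplexityLE {K σ τ : Type*} [CommSemiring K]
    (g : MvPolynomial τ K) (f : MvPolynomial σ K) (s : ℕ) : Prop :=
  ∃ k ≤ s, ∃ (D : OracleCircuit K σ τ k) (out : Operand K σ k), out.val (D.values g) = f

/-- A p-family: `f n` is a polynomial in the finitely many variables `σ n`, and the number of
variables as well as the degree of `f n` is polynomially bounded in `n`. -/
def IsPFamily {K : Type*} [CommSemiring K] {σ : ℕ → Type} [∀ n, Fintype (σ n)]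
    (f : ∀ n, MvPolynomial (σ n) K) : Prop :=
  PolyBounded (fun n => Fintype.card (σ n)) ∧ PolyBounded (fun n => (f n).totalDegree)

/-- The class VP: p-families of polynomially bounded circuit complexity. -/
def InVP {K : Type*} [CommSemiring K] {σ : ℕ → Type} [∀ n, Fintype (σ n)]
    (f : ∀ n, MvPolynomial (σ n) K) : Prop :=
  IsPFamily f ∧ ∃ s : ℕ → ℕ, PolyBounded s ∧ ∀ n, ComplexityLE (f n) (s n)

/-- The class VNP: p-families of the form `f n (x) = ∑ g n (x, ε)`, the sum being over
`ε ∈ {0,1} ^ m n`, for some family `g` in VP. (That `m` is polynomially bounded is part of `g`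
being a p-family.) -/
def InVNP {K : Type*} [CommSemiring K] {σ : ℕ → Type} [∀ n, Fintype (σ n)]
    (f : ∀ n, MvPolynomial (σ n) K) : Prop :=
  IsPFamily f ∧ ∃ (m : ℕ → ℕ) (g : ∀ n, MvPolynomial (σ n ⊕ Fin (m n)) K), InVP g ∧
    ∀ n, f n = ∑ ε : Fin (m n) → Bool,
      MvPolynomial.aeval
        (Sum.elim MvPolynomial.X (fun j => if ε j then 1 else 0) :
          σ n ⊕ Fin (m n) → MvPolynomial (σ n) K) (g n)

/-- `f` c-reduces to `g`: for a polynomially bounded `p`, the oracle complexity of `f n` with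
oracle `g (p n)` is polynomially bounded. -/
def CReduces {K : Type*} [CommSemiring K] {σ τ : ℕ → Type}
    (f : ∀ n, MvPolynomial (σ n) K) (g : ∀ n, MvPolynomial (τ n) K) : Prop :=
  ∃ p : ℕ → ℕ, PolyBounded p ∧
    ∃ s : ℕ → ℕ, PolyBounded s ∧ ∀ n, OracleComplexityLE (g (p n)) (f n) (s n)

/-- `g` is VNP-complete for c-reductions: it is in VNP, and every family in VNP c-reduces
to it. -/
def IsVNPComplete {K : Type*} [CommSemiring K] {τ : ℕ → Type} [∀ n, Fintype (τ n)]
    (g : ∀ n, MvPolynomial (τ n) K) : Prop :=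
  InVNP g ∧ ∀ (σ : ℕ → Type) [∀ n, Fintype (σ n)] (f : ∀ n, MvPolynomial (σ n) K),
    InVNP f → CReduces f g

/-- The cut enumerator `Cut²`, in `n ^ 2` independent variables: `x (i, j)` and `x (j, i)` are
different variables if `i ≠ j`. -/
noncomputable def cutEnumerator (K : Type*) [CommSemiring K] (n : ℕ) :
    MvPolynomial (Fin n × Fin n) K :=
  ∑ V : Finset (Fin n), ∏ v ∈ V, ∏ v' ∈ Vᶜ, MvPolynomial.X (v, v')

end Valiant

namespace Valiant

open MvPolynomial

/-- The cut sum of a weight matrix over an arbitrary finite vertex type. -/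
def cutSum {R V : Type*} [CommSemiring R] [Fintype V] [DecidableEq V] (x : V → V → R) : R :=
  ∑ S : V → Bool, ∏ v, ∏ v', if S v && !S v' then x v v' else 1

/-- The cut sum with additional weights `a w`, `b w` for the vertices inside and outside of
the chosen set. -/
def weightedCutSum {R W : Type*} [CommSemiring R] [Fintype W] [DecidableEq W]
    (x : W → W → R) (a b : W → R) : R :=
  ∑ S : W → Bool, (∏ w, if S w then a w else b w) *
    ∏ w, ∏ w', if S w && !S w' then x w w' else 1

theorem aeval_cutEnumerator {K R : Type*} [CommSemiring K] [CommSemiring R] [Algebra K R] (n : ℕ)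
    (x : Fin n × Fin n → R) :
    aeval x (cutEnumerator K n) = cutSum fun i j => x (i, j) := by
  classical
  simp only [cutEnumerator, cutSum, map_sum, map_prod, aeval_X]
  refine Fintype.sum_equiv
    ⟨fun V i => decide (i ∈ V), fun S => Finset.univ.filter fun i => S i = true, ?_, ?_⟩ _ _ ?_
  · intro V; ext i; simp
  · intro S; ext i; simp
  · intro V
    rw [← Finset.prod_subset (Finset.subset_univ V)]
    · refine Finset.prod_congr rfl fun v hv => ?_
      rw [← Finset.prod_subset (Finset.subset_univ Vᶜ)]
      · refine Finset.prod_congr rfl fun v' hv' => ?_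
        simp at hv'
        simp [hv, hv']
      · intro v' _ hv'
        simp at hv'
        simp [hv']
    · intro v _ hv
      simp [hv]

theorem cutSum_equiv {R V V' : Type*} [CommSemiring R] [Fintype V] [DecidableEq V]
    [Fintype V'] [DecidableEq V'] (e : V ≃ V') (x : V' → V' → R) :
    cutSum (fun v v' => x (e v) (e v')) = cutSum x := by
  unfold cutSum
  refine Fintype.sum_equiv (e.arrowCongr (Equiv.refl Bool)) _ _ fun S => ?_
  refine Fintype.prod_equiv e _ _ fun v => ?_
  refine Fintype.prod_equiv e _ _ fun v' => ?_
  simp [Equiv.arrowCongr]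

/-- The weight matrix that realizes vertex weights by edges to a source `inr true` and a sink
`inr false`, which are joined by an edge of weight `M`. -/
def pinnedMatrix {R W : Type*} [Zero R] [One R] (x : W → W → R) (a b : W → R) (M : R) :
    W ⊕ Bool → W ⊕ Bool → R
  | .inl w, .inl w' => x w w'
  | .inl w, .inr false => a w
  | .inr true, .inl w => b w
  | .inr true, .inr false => M
  | .inr false, .inr true => 0
  | _, _ => 1

theorem cutSum_pinnedMatrix_sub {R W : Type*} [CommRing R] [Fintype W] [DecidableEq W]
    (x : W → W → R) (a b : W → R) :
    cutSum (pinnedMatrix x a b 1) - cutSum (pinnedMatrix x a b 0) = weightedCutSum x a b := by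
  have key : ∀ M : R, cutSum (pinnedMatrix x a b M) =
      ∑ S : W → Bool, ∑ p : Bool × Bool,
        ∏ v, ∏ v', if (Sum.elim S (fun i => if i then p.1 else p.2) v : Bool) &&
          !(Sum.elim S (fun i => if i then p.1 else p.2) v' : Bool)
          then pinnedMatrix x a b M v v' else 1 := by
    intro M
    rw [← Fintype.sum_prod_type']
    refine Fintype.sum_equiv ((Equiv.sumArrowEquivProdArrow W Bool Bool).trans
      (Equiv.prodCongr (Equiv.refl _)
        ⟨fun f => (f true, f false), fun p i => if i then p.1 else p.2, ?_, ?_⟩)) _ _ ?_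
    · intro f; funext i; cases i <;> rfl
    · intro p; simp
    · intro S
      have : (Sum.elim (fun w => S (.inl w))
          (fun i => if i then S (.inr true) else S (.inr false)) : W ⊕ Bool → Bool) = S := by
        funext v
        rcases v with w | (_ | _) <;> simp
      simp only [Equiv.trans_apply, Equiv.prodCongr_apply, Equiv.sumArrowEquivProdArrow,
        Equiv.coe_fn_mk, Prod.map, Equiv.refl_apply, Function.comp_def]
      rw [this]
  rw [key, key, ← Finset.sum_sub_distrib]
  refine Finset.sum_congr rfl fun S _ => ?_
  simp only [Fintype.sum_prod_type, Fintype.univ_bool, Finset.sum_insert, Finset.mem_singleton,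
    Finset.sum_singleton, Fintype.prod_sum_type, Finset.prod_insert, Finset.prod_singleton,
    Bool.true_eq_false, not_false_eq_true]
  simp only [Sum.elim_inl, Sum.elim_inr, pinnedMatrix, Finset.prod_mul_distrib]
  have : ∀ w, (if S w then a w else b w) =
    (if S w = true then a w else 1) * (if S w = false then b w else 1) := by
    intro w; cases S w <;> simp
  simp only [this, Finset.prod_mul_distrib]
  simp
  ring

/-- A constant or a variable, as a polynomial. -/
noncomputable def atomVal {K σ : Type*} [CommSemiring K] : K ⊕ σ → MvPolynomial σ K :=
  Sum.elim C X

/-- A constant or a variable, as an operand. -/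
def atomOperand {K σ : Type*} (k : ℕ) : K ⊕ σ → Operand K σ k :=
  Sum.elim .const .var

theorem val_atomOperand {K σ : Type*} [CommSemiring K] {k : ℕ} (w : Fin k → MvPolynomial σ K)
    (a : K ⊕ σ) : (atomOperand k a).val w = atomVal a := by
  cases a <;> rfl

theorem oracleComplexityLE_weightedCutSum {K σ W : Type*} [CommRing K] [Fintype W] [DecidableEq W]
    (x : W → W → K ⊕ σ) (a b : W → K ⊕ σ) :
    OracleComplexityLE (cutEnumerator K (Fintype.card W + 2))
      (weightedCutSum (fun w w' => atomVal (x w w')) (fun w => atomVal (a w))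
        fun w => atomVal (b w)) 4 := by
  classical
  have hc : Fintype.card (W ⊕ Bool) = Fintype.card W + 2 := by simp
  let e : Fin (Fintype.card W + 2) ≃ W ⊕ Bool := (Fintype.equivFinOfCardEq hc).symm
  let : Zero (K ⊕ σ) := ⟨.inl 0⟩
  let : One (K ⊕ σ) := ⟨.inl 1⟩
  have h0 : atomVal (0 : K ⊕ σ) = 0 := by change C 0 = _; simp
  have h1 : atomVal (1 : K ⊕ σ) = 1 := by change C 1 = _; simp
  let y : K ⊕ σ → Fin (Fintype.card W + 2) × Fin (Fintype.card W + 2) → K ⊕ σ :=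
    fun M ij => pinnedMatrix x a b M (e ij.1) (e ij.2)
  have hy : ∀ M, aeval (fun ij => atomVal (y M ij)) (cutEnumerator K (Fintype.card W + 2)) =
      cutSum (pinnedMatrix (fun w w' => atomVal (x w w')) (fun w => atomVal (a w))
        (fun w => atomVal (b w)) (atomVal M)) := by
    intro M
    rw [aeval_cutEnumerator, ← cutSum_equiv e]
    congr 1
    funext i j
    simp only [y]
    rcases e i with w | (_ | _) <;> rcases e j with w' | (_ | _) <;>
      simp [pinnedMatrix, h0, h1]
  refine ⟨4, le_rfl,
    .add (.mul (.oracle (.oracle .nil fun t => atomOperand 0 (y 1 t))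
      fun t => atomOperand 1 (y 0 t)) (.const (-1)) (.gate 1)) (.gate 0) (.gate 2), .gate 3, ?_⟩
  rw [← cutSum_pinnedMatrix_sub, ← h1, ← h0, ← hy, ← hy]
  simp only [OracleCircuit.values, val_atomOperand]
  simp [Operand.val, Fin.snoc]
  ring

end Valiant

namespace Valiant

open MvPolynomial

/-- A constant, a variable, or the value of a Boolean, as a polynomial. -/
noncomputable def boolAtomVal {K σ B : Type*} [CommSemiring K] (ε : B → Bool) :
    K ⊕ (σ ⊕ B) → MvPolynomial σ K :=
  Sum.elim C (Sum.elim X fun j => if ε j then 1 else 0)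

/-- The sum over Boolean assignments and over choice functions `α` of products of weights, where
`α` must not choose conflicting values. -/
noncomputable def choiceSum {K σ B I A : Type*} [CommSemiring K] [Fintype B] [DecidableEq B]
    [Fintype I] [DecidableEq I] [Fintype A] (wt : I × A → K ⊕ (σ ⊕ B))
    (conf : I × A → I × A → Bool) : MvPolynomial σ K :=
  ∑ ε : B → Bool, ∑ α : I → A, (∏ c, boolAtomVal ε (wt (c, α c))) *
    ∏ c, ∏ c', if conf (c, α c) (c', α c') then 0 else 1

/-- Two choices exclude each other: they conflict, or they are different choices at the same
place. -/
def exclude {I A : Type*} [DecidableEq I] [DecidableEq A]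
    (conf : I × A → I × A → Bool) (u v : I × A) : Bool :=
  conf u v || (decide (u.1 = v.1) && !decide (u.2 = v.2))

theorem sum_choice_eq_sum_bool {R I A : Type*} [CommSemiring R]
    [Fintype I] [DecidableEq I] [Fintype A] [DecidableEq A] (f : I × A → R)
    (conf : I × A → I × A → Bool) :
    ∑ α : I → A, (∏ c, f (c, α c)) * (∏ c, ∏ c', if conf (c, α c) (c', α c') then 0 else 1) =
    ∑ t : I × A → Bool, (∏ u, if t u then f u else 1) *
      (∏ p : (I × A) × (I × A), if exclude conf p.1 p.2 && t p.1 && t p.2 then 0 else 1) *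
      ∏ c, if ∃ a, t (c, a) = true then 1 else 0 := by
  classical
  refine Fintype.sum_of_injective (fun α u => decide (α u.1 = u.2)) ?_ _ _ ?_ ?_
  · intro α β h
    funext c
    have := congrFun h (c, α c)
    simp at this
    exact this.symm
  · intro t ht
    by_cases hex : ∀ c, ∃ a, t (c, a) = true
    · choose α hα using hex
      have : ∃ u, t u = true ∧ α u.1 ≠ u.2 := by
        by_contra hcon
        push Not at hcon
        refine ht ⟨α, ?_⟩
        funext u
        cases h : t u
        · simp only [decide_eq_false_iff_not]
          rintro h'
          have := hα u.1
          rw [h'] at this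
          simp_all
        · simpa using hcon u h
      obtain ⟨u, hu, hne⟩ := this
      have : (∏ p : (I × A) × (I × A),
          if exclude conf p.1 p.2 && t p.1 && t p.2 then (0 : R) else 1) = 0 := by
        refine Finset.prod_eq_zero (Finset.mem_univ ((u.1, α u.1), u)) ?_
        simp [exclude, hu, hne, hα]
      rw [this]; simp
    · push Not at hex
      obtain ⟨c, hc⟩ := hex
      have : (∏ c, if ∃ a, t (c, a) = true then (1 : R) else 0) = 0 := by
        refine Finset.prod_eq_zero (Finset.mem_univ c) ?_
        simp [hc]
      rw [this]; simp
  · intro α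
    have h1 : (∏ c, if ∃ a, decide (α c = a) = true then (1 : R) else 0) = 1 := by
      simp
    have h2 : (∏ u : I × A, if decide (α u.1 = u.2) then f u else 1) = ∏ c, f (c, α c) := by
      rw [Fintype.prod_prod_type]
      simp
    have h3 : (∏ p : (I × A) × (I × A), if exclude conf p.1 p.2 && decide (α p.1.1 = p.1.2) &&
        decide (α p.2.1 = p.2.2) then (0 : R) else 1) =
        ∏ c, ∏ c', if conf (c, α c) (c', α c') then 0 else 1 := by
      simp only [Fintype.prod_prod_type]
      refine Finset.prod_congr rfl fun c _ => ?_
      rw [Finset.prod_eq_single (α c)]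
      · refine Finset.prod_congr rfl fun c' _ => ?_
        rw [Finset.prod_eq_single (α c')]
        · by_cases h : c = c'
          · subst h; simp [exclude]
          · simp [exclude, h]
        · intro a _ ha
          simp [ha.symm]
        · simp
      · intro a _ ha
        simp [ha.symm]
      · simp
    rw [h2, h3, h1, mul_one]

section Gadget

variable {K σ B I A : Type*} [CommRing K] [Fintype B] [DecidableEq B]
    [Fintype I] [DecidableEq I] [Fintype A] [DecidableEq A]

/-- The vertices of the graph for a choice sum: the choices, the Booleans, a vertex for
each pair of choices, and a vertex for each place. -/
abbrev ChoiceVertex (B I A : Type*) := ((I × A) ⊕ B) ⊕ (((I × A) × (I × A)) ⊕ I)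

open Classical in
/-- The edge weights of the graph for a choice sum. -/
noncomputable def choiceEdge (wt : I × A → K ⊕ (σ ⊕ B)) :
    ChoiceVertex B I A → ChoiceVertex B I A → K ⊕ σ
  | .inl (.inl u), .inl (.inr j) => if wt u = .inr (.inr j) then .inl 0 else .inl 1
  | .inl (.inl u), .inr (.inr c) => if u.1 = c then .inl 0 else .inl 1
  | .inr (.inl p), .inl (.inl u) => if u = p.1 ∨ u = p.2 then .inl 0 else .inl 1
  | _, _ => .inl 1

/-- The weights of the chosen vertices in the graph for a choice sum. -/
def choiceInside (wt : I × A → K ⊕ (σ ⊕ B)) (conf : I × A → I × A → Bool) :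
    ChoiceVertex B I A → K ⊕ σ
  | .inl (.inl u) => Sum.elim .inl (Sum.elim .inr fun _ => .inl 1) (wt u)
  | .inr (.inl p) => .inl (if exclude conf p.1 p.2 then -1 else 0)
  | _ => .inl 1

/-- The weights of the other vertices in the graph for a choice sum. -/
def choiceOutside : ChoiceVertex B I A → K ⊕ σ
  | .inr (.inr _) => .inl (-1)
  | _ => .inl 1

theorem choiceSum_eq_weightedCutSum (wt : I × A → K ⊕ (σ ⊕ B)) (conf : I × A → I × A → Bool) :
    choiceSum wt conf = weightedCutSum (fun w w' => atomVal (choiceEdge wt w w'))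
      (fun w => atomVal (choiceInside wt conf w)) fun w => atomVal (choiceOutside w) := by
  classical
  have hite : ∀ (p : Prop) [Decidable p] (a b : K ⊕ σ),
      atomVal (if p then a else b) = if p then atomVal a else atomVal b := by
    intro p _ a b; split_ifs <;> rfl
  have h0 : atomVal (.inl 0 : K ⊕ σ) = 0 := by simp [atomVal]
  have h1 : atomVal (.inl 1 : K ⊕ σ) = 1 := by simp [atomVal]
  have hm : atomVal (.inl (-1) : K ⊕ σ) = -1 := by simp [atomVal]
  let e : (ChoiceVertex B I A → Bool) ≃
      ((I × A → Bool) × (B → Bool)) × (((I × A) × (I × A) → Bool) × (I → Bool)) :=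
    (Equiv.sumArrowEquivProdArrow _ _ _).trans
      (Equiv.prodCongr (Equiv.sumArrowEquivProdArrow _ _ _) (Equiv.sumArrowEquivProdArrow _ _ _))
  unfold choiceSum weightedCutSum
  have hsum := fun ε : B → Bool => sum_choice_eq_sum_bool (fun u => boolAtomVal ε (wt u)) conf
  simp only [hsum]
  rw [← e.symm.sum_comp, Fintype.sum_prod_type, Fintype.sum_prod_type, Finset.sum_comm]
  refine Finset.sum_congr rfl fun t _ => Finset.sum_congr rfl fun ε _ => ?_
  have hS : ∀ (g : (I × A) × (I × A) → Bool) (h : I → Bool),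
      e.symm ((t, ε), (g, h)) = Sum.elim (Sum.elim t ε) (Sum.elim g h) := by
    intro g h; rfl
  rw [Fintype.sum_prod_type]
  simp only [hS, Fintype.prod_sum_type, Sum.elim_inl, Sum.elim_inr, choiceEdge, choiceInside,
    choiceOutside, hite, h0, h1, ite_self, Finset.prod_const_one, mul_one, one_mul, hm]
  have hA : ∀ u, (if t u then boolAtomVal ε (wt u) else 1) =
      (if t u then atomVal (Sum.elim .inl (Sum.elim .inr fun _ => .inl 1) (wt u) : K ⊕ σ) else 1) *
      ∏ j, if t u && !ε j then (if wt u = .inr (.inr j) then (0 : MvPolynomial σ K) else 1)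
        else 1 := by
    intro u
    cases t u
    · simp
    · rcases hw : wt u with c | i | j
      · simp [boolAtomVal, atomVal]
      · simp [boolAtomVal, atomVal]
      · simp only [boolAtomVal, Sum.elim_inr, if_true, h1, one_mul, Bool.true_and]
        cases hj : ε j
        · symm
          rw [Finset.prod_eq_zero (Finset.mem_univ j)]
          · simp
          · simp [hj]
        · symm
          rw [Finset.prod_eq_one]
          · simp
          · intro j' _
            by_cases h : j = j'
            · subst h; simp [hj]
            · simp [h]
  have hG : ∀ p : (I × A) × (I × A),
      (if exclude conf p.1 p.2 && t p.1 && t p.2 then (0 : MvPolynomial σ K) else 1) =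
      ∑ b : Bool, (if b then atomVal (.inl (if exclude conf p.1 p.2 then -1 else 0)) else 1) *
        ∏ u, if b && !t u then (if u = p.1 ∨ u = p.2 then (0 : MvPolynomial σ K) else 1)
          else 1 := by
    intro p
    rw [Fintype.sum_bool]
    cases exclude conf p.1 p.2
    · simp [h0]
    · by_cases h : t p.1 = true ∧ t p.2 = true
      · rw [Finset.prod_eq_one]
        · simp [h.1, h.2, hm]
        · intro u _
          by_cases h' : u = p.1 ∨ u = p.2
          · rcases h' with h' | h' <;> simp [h', h.1, h.2]
          · simp [h']
      · have : ∃ u, (u = p.1 ∨ u = p.2) ∧ t u = false := by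
          by_contra hcon
          push Not at hcon
          exact h ⟨by simpa using hcon p.1 (.inl rfl), by simpa using hcon p.2 (.inr rfl)⟩
        obtain ⟨u, hu, htu⟩ := this
        rw [Finset.prod_eq_zero (Finset.mem_univ u)]
        · have : ¬ ((true && t p.1 && t p.2) = true) := by simpa using h
          rw [if_neg this]
          simp
        · simp [hu, htu]
  have hH : ∀ c : I, (if ∃ a, t (c, a) = true then (1 : MvPolynomial σ K) else 0) =
      ∑ b : Bool, (if b then 1 else -1) *
        ∏ u : I × A, if t u && !b then (if u.1 = c then (0 : MvPolynomial σ K) else 1)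
          else 1 := by
    intro c
    rw [Fintype.sum_bool]
    by_cases h : ∃ a, t (c, a) = true
    · obtain ⟨a, ha⟩ := h
      rw [if_pos ⟨a, ha⟩]
      have : (∏ u : I × A, if t u && !false then
          (if u.1 = c then (0 : MvPolynomial σ K) else 1) else 1) = 0 := by
        refine Finset.prod_eq_zero (Finset.mem_univ (c, a)) ?_
        simp [ha]
      rw [this]; simp
    · rw [if_neg h]
      have : (∏ u : I × A, if t u && !false then
          (if u.1 = c then (0 : MvPolynomial σ K) else 1) else 1) = 1 := by
        refine Finset.prod_eq_one fun u _ => ?_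
        by_cases hu : u.1 = c
        · have : t u = false := by
            by_contra h'
            refine h ⟨u.2, ?_⟩
            rw [← hu]
            simpa using h'
          simp [this]
        · simp [hu]
      rw [this]; simp
  simp only [hA, hG, hH, Finset.prod_univ_sum, Fintype.piFinset_univ]
  rw [mul_assoc, Finset.sum_mul_sum, Finset.mul_sum]
  refine Finset.sum_congr rfl fun g _ => ?_
  rw [Finset.mul_sum]
  refine Finset.sum_congr rfl fun h _ => ?_
  simp only [Finset.prod_mul_distrib]
  rw [Finset.prod_comm (s := (Finset.univ : Finset I))]
  rw [show ∀ a b c d e f : MvPolynomial σ K, a * b * (c * d * (e * f)) = a * (c * e) * (b * f * d)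
    by intros; ring]
  congr! 9

theorem oracleComplexityLE_choiceSum (wt : I × A → K ⊕ (σ ⊕ B))
    (conf : I × A → I × A → Bool) :
    OracleComplexityLE (cutEnumerator K (Fintype.card (ChoiceVertex B I A) + 2))
      (choiceSum wt conf) 4 := by
  rw [choiceSum_eq_weightedCutSum]
  exact oracleComplexityLE_weightedCutSum _ _ _

end Gadget

end Valiant

namespace Valiant

/-- The state of an interval with respect to a parse tree: it does not occur, or it is a leaf with
a label, or it is an inner node with a splitting point, a label, and labels of its children. -/
abbrev ParseState (N : Type*) (D : ℕ) := Option (N ⊕ (Fin (D + 1) × N × N × N))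

/-- Intervals with end points in `{0, …, D}`. -/
abbrev Interval (D : ℕ) := Fin (D + 1) × Fin (D + 1)

/-- The label of an interval. -/
def parseLabel {N : Type*} {D : ℕ} : ParseState N D → Option N
  | none => none
  | some (.inl m) => some m
  | some (.inr (_, m, _, _)) => some m

/-- The weight of a state: leaves have length one, and splitting points are inside. -/
def parseWeight {N R : Type*} {D : ℕ} [Zero R] [One R] (w : N → R) (c : N → N → N → R)
    (J : Interval D) : ParseState N D → R
  | none => 1
  | some (.inl m) => if J.1.val + 1 = J.2.val then w m else 0
  | some (.inr (s, m, p, q)) => if J.1 < s ∧ s < J.2 then c m p q else 0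

/-- The children of an inner node must have the right labels, and other intervals that are
contained in it, but in neither of its children, must not occur. -/
def parseConflict {N : Type*} {D : ℕ} [DecidableEq N]
    (u v : Interval D × ParseState N D) : Bool :=
  match u.2 with
  | some (.inr (s, _, p, q)) => decide
      ((v.1 = (u.1.1, s) ∧ parseLabel v.2 ≠ some p) ∨ (v.1 = (s, u.1.2) ∧ parseLabel v.2 ≠ some q) ∨
        (u.1.1 ≤ v.1.1 ∧ v.1.2 ≤ u.1.2 ∧ v.1 ≠ u.1 ∧ v.1.1 < s ∧ s < v.1.2 ∧ v.2 ≠ none))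
  | _ => false

/-- The weights that force the whole interval to have label `S`. -/
def rootedWeight {N R : Type*} {D : ℕ} [DecidableEq N] [Zero R] [One R] (w : N → R)
    (c : N → N → N → R) (S : N) (u : Interval D × ParseState N D) : R :=
  if u.1 = (0, Fin.last D) ∧ parseLabel u.2 ≠ some S then 0 else parseWeight w c u.1 u.2

section Parse

variable {N R : Type*} {D : ℕ} [DecidableEq N] [CommSemiring R]

/-- The contribution of an interval to the weight of an assignment of states. -/
def parseFactor (w : N → R) (c : N → N → N → R) (α : Interval D → ParseState N D)
    (J : Interval D) : R :=
  parseWeight w c J (α J) * ∏ J', if parseConflict (J, α J) (J', α J') then 0 else 1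

/-- The nonempty intervals contained in `[k, l]`. -/
def subIntervals (k l : Fin (D + 1)) : Finset (Interval D) :=
  Finset.univ.filter fun J => k ≤ J.1 ∧ J.1 < J.2 ∧ J.2 ≤ l

theorem parseFactor_none (w : N → R) (c : N → N → N → R) (α : Interval D → ParseState N D)
    (J : Interval D) (h : α J = none) : parseFactor w c α J = 1 := by
  simp [parseFactor, h, parseWeight, parseConflict]

theorem parseFactor_congr (w : N → R) (c : N → N → N → R) (α β : Interval D → ParseState N D)
    (J : Interval D) (hJ : J.1 < J.2) (h : ∀ J' ∈ subIntervals J.1 J.2, α J' = β J') :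
    parseFactor w c α J = parseFactor w c β J := by
  have hJJ : α J = β J := h J (by simp [subIntervals, hJ])
  unfold parseFactor
  rw [← hJJ]
  rcases hα : α J with _ | m | ⟨s, m, p, q⟩
  · simp [parseConflict]
  · simp [parseConflict]
  · by_cases hs : J.1 < s ∧ s < J.2
    · congr 1
      refine Finset.prod_congr rfl fun J' _ => ?_
      by_cases hJ' : J' ∈ subIntervals J.1 J.2
      · rw [h J' hJ']
      · have h1 : J' ≠ (J.1, s) := by
          rintro rfl; exact hJ' (by simp [subIntervals, hs.1, hs.2.le])
        have h2 : J' ≠ (s, J.2) := by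
          rintro rfl; exact hJ' (by simp [subIntervals, hs.1.le, hs.2])
        have h3 : ¬ (J.1 ≤ J'.1 ∧ J'.2 ≤ J.2 ∧ J'.1 < s ∧ s < J'.2) := by
          rintro ⟨a, b, c, d⟩
          exact hJ' (by simp [subIntervals, a, b, c.trans d])
        have : ∀ a : ParseState N D,
            parseConflict (J, some (.inr (s, m, p, q))) (J', a) = false := by
          intro a
          simp only [parseConflict, decide_eq_false_iff_not]
          rintro (h' | h' | h')
          · exact h1 h'.1
          · exact h2 h'.1
          · exact h3 ⟨h'.1, h'.2.1, h'.2.2.2.1, h'.2.2.2.2.1⟩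
        rw [this, this]
    · simp [parseWeight, hs]

variable [Fintype N]

/-- Assignments for which only nonempty intervals contained in `[k, l]` occur. -/
def parseAssignments (N : Type*) [Fintype N] [DecidableEq N]
    (k l : Fin (D + 1)) : Finset (Interval D → ParseState N D) :=
  Finset.univ.filter fun α => ∀ J, J ∉ subIntervals k l → α J = none

/-- The total weight of the assignments for `[k, l]` in which that interval has label `m`. -/
def parseSum (w : N → R) (c : N → N → N → R) (k l : Fin (D + 1)) (m : N) : R :=
  ∑ α ∈ (parseAssignments N k l).filter fun α => parseLabel (α (k, l)) = some m,
    ∏ J ∈ subIntervals k l, parseFactor w c α J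

theorem parseSum_eq_sum_state (w : N → R) (c : N → N → N → R) (k l : Fin (D + 1)) (m : N) :
    parseSum w c k l m =
      (∑ α ∈ (parseAssignments N k l).filter fun α => α (k, l) = some (.inl m),
        ∏ J ∈ subIntervals k l, parseFactor w c α J) +
      ∑ s, ∑ p, ∑ q, ∑ α ∈ (parseAssignments N k l).filter
          fun α => α (k, l) = some (.inr (s, m, p, q)),
        ∏ J ∈ subIntervals k l, parseFactor w c α J := by
  have key : ∀ a : ParseState N D,
      (((parseAssignments N k l).filter fun α => parseLabel (α (k, l)) = some m).filter
        fun α => α (k, l) = a) =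
      if parseLabel a = some m then (parseAssignments N k l).filter fun α => α (k, l) = a
      else ∅ := by
    intro a
    split_ifs with h
    · ext α; simp only [Finset.mem_filter]; constructor
      · rintro ⟨⟨h1, _⟩, h3⟩; exact ⟨h1, h3⟩
      · rintro ⟨h1, h3⟩; exact ⟨⟨h1, by rw [h3, h]⟩, h3⟩
    · ext α
      simp only [Finset.mem_filter, Finset.notMem_empty, iff_false]
      rintro ⟨⟨_, h2⟩, h3⟩
      exact h (h3 ▸ h2)
  unfold parseSum
  rw [← Finset.sum_fiberwise _ (fun α => α (k, l))]
  simp only [key]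
  rw [Fintype.sum_option, Fintype.sum_sum_type]
  simp only [Fintype.sum_prod_type, parseLabel, reduceCtorEq, if_false, Finset.sum_empty, zero_add,
    Option.some.injEq]
  congr 1
  · rw [Finset.sum_eq_single m]
    · simp
    · intro b _ hb; simp [hb]
    · simp
  · refine Finset.sum_congr rfl fun s _ => ?_
    rw [Finset.sum_eq_single m]
    · simp
    · intro b _ hb; simp [hb]
    · simp

theorem sum_leaf_eq (w : N → R) (c : N → N → N → R) (k l : Fin (D + 1)) (hkl : k < l) (m : N) :
    (∑ α ∈ (parseAssignments N k l).filter fun α => α (k, l) = some (.inl m),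
        ∏ J ∈ subIntervals k l, parseFactor w c α J) =
      if k.val + 1 = l.val then w m else 0 := by
  have hmem : (k, l) ∈ subIntervals k l := by simp [subIntervals, hkl]
  split_ifs with h
  · have hsub : subIntervals k l = {(k, l)} := by
      ext ⟨a, b⟩
      simp only [subIntervals, Finset.mem_filter, Finset.mem_univ, true_and, Finset.mem_singleton,
        Prod.mk.injEq, Fin.le_def, Fin.lt_def, Fin.ext_iff]
      omega
    have hset : ((parseAssignments N k l).filter fun α => α (k, l) = some (.inl m)) =
        {Function.update (fun _ => none) (k, l) (some (.inl m))} := by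
      ext α
      simp only [parseAssignments, Finset.mem_filter, Finset.mem_univ, true_and,
        Finset.mem_singleton, hsub]
      constructor
      · rintro ⟨h1, h2⟩
        funext J
        by_cases hJ : J = (k, l)
        · subst hJ; simp [h2]
        · simp [Function.update_of_ne hJ, h1 J hJ]
      · rintro rfl
        refine ⟨fun J hJ => by simp [Function.update_of_ne hJ], by simp⟩
    rw [hset, hsub]
    simp [parseFactor, parseWeight, parseConflict, h]
  · refine Finset.sum_eq_zero fun α hα => Finset.prod_eq_zero hmem ?_
    rw [Finset.mem_filter] at hα
    simp [parseFactor, hα.2, parseWeight, h]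

/-- Two assignments joined below an inner node. -/
def joinAssignments (k s l : Fin (D + 1)) (a : ParseState N D)
    (α β : Interval D → ParseState N D) (J : Interval D) : ParseState N D :=
  if J = (k, l) then a else if J ∈ subIntervals k s then α J else
    if J ∈ subIntervals s l then β J else none

theorem sum_node_eq (w : N → R) (c : N → N → N → R) (k l s : Fin (D + 1)) (m p q : N) (hkl : k < l) :
    (∑ α ∈ (parseAssignments N k l).filter fun α => α (k, l) = some (.inr (s, m, p, q)),
        ∏ J ∈ subIntervals k l, parseFactor w c α J) =
      if k < s ∧ s < l then c m p q * (parseSum w c k s p * parseSum w c s l q) else 0 := by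
  have hmem : (k, l) ∈ subIntervals k l := by simp [subIntervals, hkl]
  split_ifs with hs
  swap
  · refine Finset.sum_eq_zero fun α hα => Finset.prod_eq_zero hmem ?_
    rw [Finset.mem_filter] at hα
    simp [parseFactor, hα.2, parseWeight, hs]
  obtain ⟨hks, hsl⟩ := hs
  have mem_sub : ∀ a b (J : Interval D), J ∈ subIntervals a b ↔ a ≤ J.1 ∧ J.1 < J.2 ∧ J.2 ≤ b := by
    intro a b J; simp [subIntervals]
  have hdisj : ∀ J, J ∈ subIntervals k s → J ∉ subIntervals s l := by
    intro J h1 h2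
    rw [mem_sub] at h1 h2
    exact absurd (h1.2.1.trans_le h1.2.2) (not_lt.2 h2.1)
  have hne1 : (k, l) ∉ subIntervals k s := by
    rw [mem_sub]; rintro ⟨_, _, h⟩; exact absurd hsl (not_lt.2 h)
  have hne2 : (k, l) ∉ subIntervals s l := by
    rw [mem_sub]; rintro ⟨h, _⟩; exact absurd hks (not_lt.2 h)
  have hin1 : ∀ J ∈ subIntervals k s, J ∈ subIntervals k l := by
    intro J; simp only [mem_sub]; rintro ⟨h1, h2, h3⟩; exact ⟨h1, h2, h3.trans hsl.le⟩
  have hin2 : ∀ J ∈ subIntervals s l, J ∈ subIntervals k l := by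
    intro J; simp only [mem_sub]; rintro ⟨h1, h2, h3⟩; exact ⟨hks.le.trans h1, h2, h3⟩
  have htrans : ∀ a b (J J' : Interval D), J ∈ subIntervals a b → J' ∈ subIntervals J.1 J.2 →
      J' ∈ subIntervals a b := by
    intro a b J J'; simp only [mem_sub]
    rintro ⟨h1, h2, h3⟩ ⟨h4, h5, h6⟩
    exact ⟨h1.trans h4, h5, h6.trans h3⟩
  have hleft : (k, s) ∈ subIntervals k s := by simp [mem_sub, hks]
  have hright : (s, l) ∈ subIntervals s l := by simp [mem_sub, hsl]
  obtain ⟨good, hgood⟩ : ∃ good : (Interval D → ParseState N D) → Prop, ∀ α, good α ↔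
      parseLabel (α (k, s)) = some p ∧ parseLabel (α (s, l)) = some q ∧
      ∀ J ∈ subIntervals k l, J ≠ (k, l) → J ∉ subIntervals k s → J ∉ subIntervals s l →
        α J = none := ⟨_, fun _ => Iff.rfl⟩
  classical
  have hprod : ∀ α ∈ (parseAssignments N k l).filter
      fun α => α (k, l) = some (.inr (s, m, p, q)),
      ∏ J ∈ subIntervals k l, parseFactor w c α J = if good α then c m p q *
        ((∏ J ∈ subIntervals k s, parseFactor w c α J) *
          ∏ J ∈ subIntervals s l, parseFactor w c α J) else 0 := by
    intro α hα
    rw [Finset.mem_filter] at hα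
    have hroot : parseFactor w c α (k, l) = if good α then c m p q else 0 := by
      unfold parseFactor
      rw [hα.2]
      simp only [parseWeight, hks, hsl, and_self, if_true]
      split_ifs with hg
      · rw [hgood] at hg
        rw [Finset.prod_eq_one, mul_one]
        intro J _
        rw [if_neg]
        simp only [parseConflict, decide_eq_true_eq]
        rintro (h' | h' | ⟨h1, h2, h3, h4, h5, h6⟩)
        · exact h'.2 (h'.1 ▸ hg.1)
        · exact h'.2 (h'.1 ▸ hg.2.1)
        · refine h6 (hg.2.2 J ?_ h3 ?_ ?_)
          · rw [mem_sub]; exact ⟨h1, h4.trans h5, h2⟩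
          · rw [mem_sub]; rintro ⟨_, _, h⟩; exact absurd h5 (not_lt.2 h)
          · rw [mem_sub]; rintro ⟨h, _⟩; exact absurd h4 (not_lt.2 h)
      · have : ∃ J, parseConflict ((k, l), some (.inr (s, m, p, q))) (J, α J) = true := by
          by_contra hcon
          push Not at hcon
          simp only [parseConflict, ne_eq, decide_eq_true_eq, not_or, not_and, not_not] at hcon
          refine hg ((hgood α).2 ⟨(hcon (k, s)).1 rfl, (hcon (s, l)).2.1 rfl, fun J hJ hJ1 hJ2 hJ3 => ?_⟩)
          rw [mem_sub] at hJ hJ2 hJ3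
          refine (hcon J).2.2 hJ.1 hJ.2.2 hJ1 ?_ ?_
          · by_contra h; exact hJ3 ⟨not_lt.1 h, hJ.2.1, hJ.2.2⟩
          · by_contra h; exact hJ2 ⟨hJ.1, hJ.2.1, not_lt.1 h⟩
        obtain ⟨J, hJ⟩ := this
        rw [Finset.prod_eq_zero (Finset.mem_univ J), mul_zero]
        simp [hJ]
    rw [← Finset.mul_prod_erase _ _ hmem, hroot]
    split_ifs with hg
    swap
    · simp
    rw [hgood] at hg
    congr 1
    rw [← Finset.prod_union (Finset.disjoint_left.2 hdisj)]
    symm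
    refine Finset.prod_subset ?_ ?_
    · intro J hJ
      rw [Finset.mem_union] at hJ
      rw [Finset.mem_erase]
      rcases hJ with hJ | hJ
      · exact ⟨fun h => hne1 (h ▸ hJ), hin1 J hJ⟩
      · exact ⟨fun h => hne2 (h ▸ hJ), hin2 J hJ⟩
    · intro J hJ hJ'
      rw [Finset.mem_erase] at hJ
      rw [Finset.mem_union, not_or] at hJ'
      exact parseFactor_none _ _ _ _ (hg.2.2 J hJ.2 hJ.1 hJ'.1 hJ'.2)
  rw [Finset.sum_congr rfl hprod, ← Finset.sum_filter good, ← Finset.mul_sum]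
  congr 1
  unfold parseSum
  rw [Finset.sum_mul_sum, ← Finset.sum_product']
  refine Finset.sum_bij'
    (fun α _ => (fun J => if J ∈ subIntervals k s then α J else none,
      fun J => if J ∈ subIntervals s l then α J else none))
    (fun αβ _ => joinAssignments k s l (some (.inr (s, m, p, q))) αβ.1 αβ.2) ?_ ?_ ?_ ?_ ?_
  · intro α hα
    simp only [Finset.mem_filter, parseAssignments, Finset.mem_univ, true_and, hgood] at hα
    simp only [Finset.mem_product, Finset.mem_filter, parseAssignments, Finset.mem_univ, true_and,
      hleft, hright, if_true]
    exact ⟨⟨fun J hJ => by simp [hJ], hα.2.1⟩, ⟨fun J hJ => by simp [hJ], hα.2.2.1⟩⟩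
  · rintro ⟨α, β⟩ hαβ
    simp only [Finset.mem_product, Finset.mem_filter, parseAssignments, Finset.mem_univ,
      true_and] at hαβ
    simp only [Finset.mem_filter, parseAssignments, Finset.mem_univ, true_and, hgood]
    refine ⟨⟨fun J hJ => ?_, by simp [joinAssignments]⟩, ?_, ?_, ?_⟩
    · have h0 : J ≠ (k, l) := fun h => hJ (h ▸ hmem)
      have h1 : J ∉ subIntervals k s := fun h => hJ (hin1 J h)
      have h2 : J ∉ subIntervals s l := fun h => hJ (hin2 J h)
      simp [joinAssignments, h0, h1, h2]
    · have h0 : (k, s) ≠ (k, l) := fun h => hne1 (h ▸ hleft)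
      simp only [joinAssignments, h0, if_false, hleft, if_true]
      exact hαβ.1.2
    · have h0 : (s, l) ≠ (k, l) := fun h => hne2 (h ▸ hright)
      have h1 : (s, l) ∉ subIntervals k s := fun h => hdisj _ h hright
      simp only [joinAssignments, h0, if_false, hright, if_true, h1]
      exact hαβ.2.2
    · intro J _ h0 h1 h2
      simp [joinAssignments, h0, h1, h2]
  · intro α hα
    simp only [Finset.mem_filter, parseAssignments, Finset.mem_univ, true_and, hgood] at hα
    funext J
    simp only [joinAssignments]
    split_ifs with h0 h1 h2
    · rw [h0, hα.1.2]
    · rfl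
    · rfl
    · by_cases hJ : J ∈ subIntervals k l
      · exact (hα.2.2.2 J hJ h0 h1 h2).symm
      · exact (hα.1.1 J hJ).symm
  · rintro ⟨α, β⟩ hαβ
    simp only [Finset.mem_product, Finset.mem_filter, parseAssignments, Finset.mem_univ,
      true_and] at hαβ
    refine Prod.ext ?_ ?_
    · funext J
      simp only [joinAssignments]
      split_ifs with h1 h0
      · exact absurd (h0 ▸ h1) hne1
      · rfl
      · exact (hαβ.1.1 J h1).symm
    · funext J
      simp only [joinAssignments]
      split_ifs with h1 h0 h2
      · exact absurd (h0 ▸ h1) hne2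
      · exact absurd h1 (hdisj J h2)
      · rfl
      · exact (hαβ.2.1 J h1).symm
  · intro α hα
    simp only
    congr 1
    · refine Finset.prod_congr rfl fun J hJ => ?_
      refine parseFactor_congr _ _ _ _ _ ((mem_sub _ _ _).1 hJ).2.1 fun J' hJ' => ?_
      simp [htrans _ _ _ _ hJ hJ']
    · refine Finset.prod_congr rfl fun J hJ => ?_
      refine parseFactor_congr _ _ _ _ _ ((mem_sub _ _ _).1 hJ).2.1 fun J' hJ' => ?_
      simp [htrans _ _ _ _ hJ hJ']

/-- The family `h` satisfies the recursion that belongs to a weighted grammar in Chomsky normal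
form: `h m i` is the total weight of the parse trees with root `m` and with `i` leaves. -/
def IsParseSeries (w : N → R) (c : N → N → N → R) (h : N → PowerSeries R) : Prop :=
  ∀ m, PowerSeries.constantCoeff (h m) = 0 ∧
    h m = PowerSeries.C (w m) * PowerSeries.X +
      ∑ p, ∑ q, PowerSeries.C (c m p q) * (h p * h q)

theorem parseSum_eq_coeff {w : N → R} {c : N → N → N → R} {h : N → PowerSeries R}
    (hh : IsParseSeries w c h) (n : ℕ) (k l : Fin (D + 1)) (hkl : k < l)
    (hn : l.val = k.val + n) (m : N) :
    parseSum w c k l m = PowerSeries.coeff n (h m) := by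
  induction n using Nat.strong_induction_on generalizing k l m with
  | _ n ih =>
    rw [parseSum_eq_sum_state, sum_leaf_eq _ _ _ _ hkl]
    simp only [sum_node_eq _ _ _ _ _ _ _ _ hkl]
    rw [(hh m).2, map_add]
    have h0 : ∀ m, PowerSeries.coeff 0 (h m) = 0 := fun m => by
      rw [PowerSeries.coeff_zero_eq_constantCoeff_apply, (hh m).1]
    congr 1
    · rw [PowerSeries.coeff_C_mul, PowerSeries.coeff_X, hn]
      by_cases h1 : n = 1
      · simp [h1]
      · simp [h1, Ne.symm h1]
    · simp only [map_sum, PowerSeries.coeff_C_mul]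
      simp only [PowerSeries.coeff_mul]
      rw [Finset.sum_comm]
      refine Finset.sum_congr rfl fun p _ => ?_
      rw [Finset.sum_comm]
      refine Finset.sum_congr rfl fun q _ => ?_
      rw [Finset.mul_sum, ← Finset.sum_filter]
      have hz : ∀ x ∈ Finset.HasAntidiagonal.antidiagonal n, ¬ (0 < x.1 ∧ 0 < x.2) →
          c m p q * (PowerSeries.coeff x.1 (h p) * PowerSeries.coeff x.2 (h q)) = 0 := by
        rintro ⟨i, j⟩ _ hx
        rcases Nat.eq_zero_or_pos i with rfl | hi
        · simp [h0]
        · rcases Nat.eq_zero_or_pos j with rfl | hj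
          · simp [h0]
          · exact absurd ⟨hi, hj⟩ hx
      rw [← Finset.sum_filter_of_ne (s := Finset.HasAntidiagonal.antidiagonal n)
        (p := fun x => 0 < x.1 ∧ 0 < x.2) fun x hx hne => by
          by_contra hcon; exact hne (hz x hx hcon)]
      refine Finset.sum_bij' (fun s _ => (s.val - k.val, l.val - s.val))
        (fun x hx => ⟨k.val + x.1, ?_⟩) ?_ ?_ ?_ ?_ ?_
      · simp only [Finset.mem_filter, Finset.HasAntidiagonal.mem_antidiagonal] at hx
        have := l.isLt
        omega
      · intro s hs
        simp only [Finset.mem_filter, Finset.mem_univ, true_and, Fin.lt_def,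
          Finset.HasAntidiagonal.mem_antidiagonal] at hs ⊢
        omega
      · intro x hx
        simp only [Finset.mem_filter, Finset.mem_univ, true_and, Fin.lt_def,
          Finset.HasAntidiagonal.mem_antidiagonal] at hx ⊢
        omega
      · intro s hs
        simp only [Finset.mem_filter, Finset.mem_univ, true_and, Fin.lt_def] at hs
        ext
        simp only
        omega
      · rintro ⟨i, j⟩ hx
        simp only [Finset.mem_filter, Finset.HasAntidiagonal.mem_antidiagonal] at hx
        simp only [Prod.mk.injEq]
        omega
      · intro s hs
        simp only [Finset.mem_filter, Finset.mem_univ, true_and, Fin.lt_def] at hs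
        rw [ih (s.val - k.val) (by omega) k s (Fin.lt_def.2 hs.1) (by omega),
          ih (l.val - s.val) (by omega) s l (Fin.lt_def.2 hs.2) (by omega)]

theorem sum_rootedWeight {w : N → R} {c : N → N → N → R} {h : N → PowerSeries R}
    (hh : IsParseSeries w c h) (hD : 0 < D) (S : N) :
    ∑ α : Interval D → ParseState N D, (∏ J, rootedWeight w c S (J, α J)) *
      (∏ J, ∏ J', if parseConflict (J, α J) (J', α J') then 0 else 1) =
    PowerSeries.coeff D (h S) := by
  have hlt : (0 : Fin (D + 1)) < Fin.last D := by simpa [Fin.lt_def] using hD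
  rw [← parseSum_eq_coeff hh D 0 (Fin.last D) hlt (by simp), parseSum]
  symm
  rw [← Finset.sum_subset (Finset.subset_univ ((parseAssignments N 0 (Fin.last D)).filter
    fun α => parseLabel (α (0, Fin.last D)) = some S))]
  rotate_left
  · intro α _ hα
    simp only [Finset.mem_univ, true_and, Finset.mem_filter, parseAssignments,
      not_and_or, not_forall] at hα
    rcases hα with ⟨J, hJ, hne⟩ | hα
    · rw [Finset.prod_eq_zero (Finset.mem_univ J), zero_mul]
      have hJ' : ¬ J.1 < J.2 := by
        intro h'
        exact hJ (by simp [subIntervals, h', Fin.le_last])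
      unfold rootedWeight
      split_ifs
      · rfl
      · rcases hs : α J with _ | m | ⟨s, m, p, q⟩
        · exact absurd hs hne
        · have : ¬ (J.1.val + 1 = J.2.val) := by
            intro h'; exact hJ' (Fin.lt_def.2 (by omega))
          simp [parseWeight, this]
        · have : ¬ (J.1 < s ∧ s < J.2) := fun h' => hJ' (h'.1.trans h'.2)
          simp [parseWeight, this]
    · rw [Finset.prod_eq_zero (Finset.mem_univ (0, Fin.last D)), zero_mul]
      simp [rootedWeight, hα]
  · refine Finset.sum_congr rfl fun α hα => ?_
    simp only [Finset.mem_filter, parseAssignments, Finset.mem_univ, true_and] at hα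
    rw [← Finset.prod_mul_distrib]
    rw [Finset.prod_subset (Finset.subset_univ (subIntervals 0 (Fin.last D)))]
    · refine Finset.prod_congr rfl fun J _ => ?_
      unfold parseFactor rootedWeight
      rw [if_neg]
      rintro ⟨h1, h2⟩
      simp only at h1
      subst h1
      exact h2 hα.2
    · intro J _ hJ
      exact parseFactor_none _ _ _ _ (hα.1 J hJ)

end Parse

end Valiant

namespace Valiant

open MvPolynomial

section Grading

variable {K τ : Type*} [CommRing K]

/-- The homomorphism that marks the degree by a formal variable. -/
noncomputable def gradingHom (K τ : Type*) [CommRing K] :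
    MvPolynomial τ K →ₐ[K] PowerSeries (MvPolynomial τ K) :=
  aeval fun i => PowerSeries.C (X i) * PowerSeries.X

theorem gradingHom_C (a : K) : gradingHom K τ (C a) = PowerSeries.C (C a) := by
  rw [gradingHom, aeval_C, PowerSeries.algebraMap_apply, algebraMap_eq]

theorem gradingHom_monomial (s : τ →₀ ℕ) (a : K) :
    gradingHom K τ (monomial s a) = PowerSeries.C (monomial s a) * PowerSeries.X ^ s.degree := by
  rw [monomial_eq, map_mul, gradingHom_C, map_mul, mul_assoc]
  congr 1
  simp only [Finsupp.prod, map_prod, map_pow, gradingHom, aeval_X, mul_pow,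
    Finset.prod_mul_distrib, Finset.prod_pow_eq_pow_sum]
  rfl

theorem sum_coeff_gradingHom (f : MvPolynomial τ K) {d : ℕ} (hd : f.totalDegree ≤ d) :
    ∑ i ∈ Finset.range (d + 1), PowerSeries.coeff i (gradingHom K τ f) = f := by
  conv_lhs => rw [f.as_sum]
  conv_rhs => rw [f.as_sum]
  simp only [map_sum]
  rw [Finset.sum_comm]
  refine Finset.sum_congr rfl fun s hs => ?_
  have hsd : s.degree ≤ d := (le_totalDegree hs).trans hd
  simp only [gradingHom_monomial, PowerSeries.coeff_C_mul, PowerSeries.coeff_X_pow]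
  rw [Finset.sum_eq_single s.degree]
  · simp
  · intro i _ hi; simp [hi]
  · intro h; exact absurd (Finset.mem_range.2 (by omega)) h

/-- A polynomial is a constant plus a linear combination of the series `h`. -/
def IsLinComb {N : Type*} [Fintype N] (h : N → PowerSeries (MvPolynomial τ K))
    (f : MvPolynomial τ K) : Prop :=
  ∃ (a : K) (μ : N → K), gradingHom K τ f =
    PowerSeries.C (C a) + ∑ p, PowerSeries.C (C (μ p)) * h p

theorem IsLinComb.add {N : Type*} [Fintype N] {h : N → PowerSeries (MvPolynomial τ K)}
    {f g : MvPolynomial τ K} (hf : IsLinComb h f) (hg : IsLinComb h g) : IsLinComb h (f + g) := by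
  obtain ⟨a, μ, hf⟩ := hf
  obtain ⟨b, ν, hg⟩ := hg
  refine ⟨a + b, μ + ν, ?_⟩
  simp only [map_add, hf, hg, Pi.add_apply, add_mul, Finset.sum_add_distrib]
  ring

theorem IsLinComb.const {N : Type*} [Fintype N] (h : N → PowerSeries (MvPolynomial τ K)) (a : K) :
    IsLinComb h (C a) :=
  ⟨a, 0, by rw [gradingHom_C]; simp⟩

theorem IsLinComb.operand {N : Type*} [Fintype N] {h : N → PowerSeries (MvPolynomial τ K)} {k : ℕ}
    {v : Fin k → MvPolynomial τ K} (hX : ∀ i, IsLinComb h (X i)) (hv : ∀ j, IsLinComb h (v j))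
    (o : Operand K τ k) : IsLinComb h (o.val v) := by
  cases o with
  | const c => exact .const h c
  | var i => exact hX i
  | gate j => exact hv j

/-- The grammar with coefficients and atoms from `K` and `τ`. -/
def IsGrammarSeries {N : Type*} [Fintype N] (w : N → K ⊕ τ) (c : N → N → N → K)
    (h : N → PowerSeries (MvPolynomial τ K)) : Prop :=
  IsParseSeries (fun m => atomVal (w m)) (fun m p q => C (c m p q)) h

/-- The coefficients of a grammar extended by a label for a product of linear combinations. -/
def productCoeff {N : Type*} (c : N → N → N → K) (μ ν : N → K) :
    Option N → Option N → Option N → K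
  | some m, some p, some q => c m p q
  | none, some p, some q => μ p * ν q
  | _, _, _ => 0

theorem exists_grammarSeries_mul {N : Type} [Fintype N] {w : N → K ⊕ τ} {c : N → N → N → K}
    {h : N → PowerSeries (MvPolynomial τ K)} (hh : IsGrammarSeries w c h)
    {f g : MvPolynomial τ K} (hf : IsLinComb h f) (hg : IsLinComb h g) :
    ∃ (w' : Option N → K ⊕ τ) (c' : Option N → Option N → Option N → K)
      (h' : Option N → PowerSeries (MvPolynomial τ K)), IsGrammarSeries w' c' h' ∧
      IsLinComb h' (f * g) ∧ ∀ u, IsLinComb h u → IsLinComb h' u := by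
  obtain ⟨a, μ, hf⟩ := hf
  obtain ⟨b, ν, hg⟩ := hg
  let H : PowerSeries (MvPolynomial τ K) :=
    (∑ p, PowerSeries.C (C (μ p)) * h p) * ∑ q, PowerSeries.C (C (ν q)) * h q
  refine ⟨fun m => m.elim (.inl 0) w, productCoeff c μ ν, fun m => m.elim H h, ?_, ?_, ?_⟩
  · rintro (_ | m)
    · refine ⟨?_, ?_⟩
      · simp [H, (hh _).1]
      · simp only [Fintype.sum_option, productCoeff, Option.elim, atomVal, Sum.elim_inl, map_zero,
          zero_mul, Finset.sum_const_zero, zero_add, H, Finset.sum_mul_sum, map_mul]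
        refine Finset.sum_congr rfl fun p _ => Finset.sum_congr rfl fun q _ => ?_
        ring
    · refine ⟨(hh m).1, ?_⟩
      simp only [Fintype.sum_option, productCoeff, Option.elim, map_zero,
          zero_mul, Finset.sum_const_zero, zero_add]
      exact (hh m).2
  · refine ⟨a * b, fun m => m.elim 1 fun p => a * ν p + b * μ p, ?_⟩
    simp only [map_mul, hf, hg, Fintype.sum_option, Option.elim, H, map_add, map_one, add_mul,
      Finset.sum_add_distrib, mul_assoc, ← Finset.mul_sum]
    ring
  · rintro u ⟨a', κ, hu⟩
    refine ⟨a', fun m => m.elim 0 κ, ?_⟩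
    simp [hu, Fintype.sum_option]

end Grading

section Circuit

variable {K : Type*} {τ : Type} [CommRing K] [Fintype τ]

theorem Circuit.exists_grammarSeries {k : ℕ} (D : Circuit K τ k) :
    ∃ (N : Type) (_ : Fintype N) (w : N → K ⊕ τ) (c : N → N → N → K)
      (h : N → PowerSeries (MvPolynomial τ K)), Fintype.card N ≤ Fintype.card τ + k ∧
      IsGrammarSeries w c h ∧ (∀ i, IsLinComb h (X i)) ∧ ∀ j, IsLinComb h (D.values j) := by
  classical
  induction D with
  | nil =>
    refine ⟨τ, inferInstance, .inr, 0, fun i => PowerSeries.C (X i) * PowerSeries.X, by simp,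
      ?_, ?_, fun j => j.elim0⟩
    · intro i
      exact ⟨by simp, by simp [atomVal]⟩
    · intro i
      refine ⟨0, Pi.single i 1, ?_⟩
      rw [Finset.sum_eq_single i]
      · simp [gradingHom]
      · intro j _ hj; simp [hj]
      · simp
  | @add k D a b ih =>
    obtain ⟨N, _, w, c, h, hN, hh, hX, hv⟩ := ih
    refine ⟨N, inferInstance, w, c, h, by omega, hh, hX, fun j => ?_⟩
    refine Fin.lastCases ?_ (fun j => ?_) j
    · simpa [Circuit.values] using (IsLinComb.operand hX hv a).add (.operand hX hv b)
    · simpa [Circuit.values] using hv j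
  | @mul k D a b ih =>
    obtain ⟨N, _, w, c, h, hN, hh, hX, hv⟩ := ih
    obtain ⟨w', c', h', hh', hm, hu⟩ :=
      exists_grammarSeries_mul hh (.operand hX hv a) (.operand hX hv b)
    refine ⟨Option N, inferInstance, w', c', h', ?_, hh', fun i => hu _ (hX i), fun j => ?_⟩
    · rw [Fintype.card_option]; omega
    · refine Fin.lastCases ?_ (fun j => ?_) j
      · simpa [Circuit.values] using hm
      · simpa [Circuit.values] using hu _ (hv j)

/-- The coefficients of a grammar extended by a leaf `0` of weight one, lists `1` of such leaves,
and a start symbol `2` for an affine linear combination that is followed by a list. -/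
def startCoeff {N : Type*} (c : N → N → N → K) (a : K) (μ : N → K) :
    N ⊕ Fin 3 → N ⊕ Fin 3 → N ⊕ Fin 3 → K
  | .inl m, .inl p, .inl q => c m p q
  | .inr 1, .inr 0, .inr 1 => 1
  | .inr 2, .inl p, .inr 1 => μ p
  | .inr 2, .inr 0, .inr 1 => a
  | _, _, _ => 0

theorem exists_grammarSeries_coeff {f : MvPolynomial τ K} {s d : ℕ} (hf : ComplexityLE f s)
    (hd : f.totalDegree ≤ d) (hd1 : 1 ≤ d) :
    ∃ (N : Type) (_ : Fintype N) (w : N → K ⊕ τ) (c : N → N → N → K)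
      (h : N → PowerSeries (MvPolynomial τ K)) (S : N),
      Fintype.card N ≤ Fintype.card τ + s + 3 ∧
      IsGrammarSeries w c h ∧ PowerSeries.coeff (d + 1) (h S) = f := by
  obtain ⟨k, hk, D, out, hout⟩ := hf
  obtain ⟨N, _, w, c, h, hN, hh, hX, hv⟩ := D.exists_grammarSeries
  obtain ⟨a, μ, hf⟩ := hout ▸ IsLinComb.operand hX hv out
  let G : PowerSeries (MvPolynomial τ K) := PowerSeries.X * PowerSeries.mk 1
  have hG : G = PowerSeries.X + PowerSeries.X * G := by
    have : (PowerSeries.mk 1 : PowerSeries (MvPolynomial τ K)) =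
        1 + PowerSeries.X * PowerSeries.mk 1 := by
      ext n
      cases n <;> simp [PowerSeries.coeff_succ_X_mul, PowerSeries.coeff_one]
    calc G = PowerSeries.X * (1 + PowerSeries.X * PowerSeries.mk 1) := by rw [← this]
      _ = _ := by simp only [G]; ring
  let A : PowerSeries (MvPolynomial τ K) := ∑ p, PowerSeries.C (C (μ p)) * h p
  let hS : PowerSeries (MvPolynomial τ K) := (A + PowerSeries.C (C a) * PowerSeries.X) * G
  refine ⟨N ⊕ Fin 3, inferInstance, Sum.elim w ![.inl 1, .inl 1, .inl 0], startCoeff c a μ,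
    Sum.elim h ![PowerSeries.X, G, hS], .inr 2, ?_, ?_, ?_⟩
  · simp only [Fintype.card_sum, Fintype.card_fin]; omega
  · rintro (m | j)
    · refine ⟨(hh m).1, ?_⟩
      simp only [Fintype.sum_sum_type, startCoeff, Sum.elim_inl, map_zero,
        zero_mul, Finset.sum_const_zero, add_zero]
      exact (hh m).2
    · fin_cases j
      · refine ⟨by simp, ?_⟩
        simp [startCoeff, atomVal]
      · refine ⟨by simp [G], ?_⟩
        simpa [Fintype.sum_sum_type, Fin.sum_univ_three, startCoeff, atomVal] using hG
      · refine ⟨by simp [G, hS], ?_⟩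
        simp [Fintype.sum_sum_type, Fin.sum_univ_three, startCoeff, atomVal, hS, A, add_mul,
          Finset.sum_mul, mul_assoc]
  · have hcoeff : ∀ B : PowerSeries (MvPolynomial τ K), PowerSeries.coeff (d + 1) (B * G) =
        ∑ i ∈ Finset.range (d + 1), PowerSeries.coeff i B := by
      intro B
      have : B * G = PowerSeries.X * (B * PowerSeries.mk 1) := by simp only [G]; ring
      rw [this, PowerSeries.coeff_succ_X_mul, PowerSeries.coeff_mul,
        Finset.Nat.sum_antidiagonal_eq_sum_range_succ_mk]
      simp
    change PowerSeries.coeff (d + 1) hS = f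
    conv_rhs => rw [← sum_coeff_gradingHom f hd, hf]
    rw [hcoeff]
    simp only [map_add, Finset.sum_add_distrib]
    rw [add_comm]
    congr 1
    simp only [PowerSeries.coeff_C_mul, PowerSeries.coeff_X, PowerSeries.coeff_C]
    rw [Finset.sum_eq_single 1, Finset.sum_eq_single 0]
    · simp
    · intro i _ hi; simp [hi]
    · simp
    · intro i _ hi; simp [hi]
    · intro h'; exact absurd (Finset.mem_range.2 (by omega)) h'

end Circuit

end Valiant

namespace Valiant

open MvPolynomial

section Hardness

variable {K : Type*} [CommRing K]

theorem atomVal_rootedWeight {N τ : Type*} {D : ℕ} [DecidableEq N] (w : N → K ⊕ τ)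
    (c : N → N → N → K) (S : N) (u : Interval D × ParseState N D) :
    atomVal (@rootedWeight N (K ⊕ τ) D _ ⟨.inl 0⟩ ⟨.inl 1⟩ w (fun m p q => .inl (c m p q)) S u) =
      rootedWeight (fun m => atomVal (w m)) (fun m p q => C (c m p q)) S u := by
  have h0 : atomVal (.inl 0 : K ⊕ τ) = 0 := by simp [atomVal]
  have h1 : atomVal (.inl 1 : K ⊕ τ) = 1 := by simp [atomVal]
  unfold rootedWeight
  split_ifs
  · exact h0
  · rcases u.2 with _ | m | ⟨s, m, p, q⟩
    · exact h1
    · simp only [parseWeight]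
      split_ifs
      · rfl
      · exact h0
    · simp only [parseWeight]
      split_ifs
      · rfl
      · exact h0

theorem aeval_atomVal {σ B : Type*} (ε : B → Bool) (a : K ⊕ (σ ⊕ B)) :
    aeval (Sum.elim X (fun j => if ε j then 1 else 0) : σ ⊕ B → MvPolynomial σ K) (atomVal a) =
      boolAtomVal ε a := by
  rcases a with c | i | j <;> simp [atomVal, boolAtomVal]

/-- The number of vertices that suffices for a Boolean sum over `m` variables, with a grammar that
has `k` labels, and for parse trees with `D` leaves. -/
def vertexBound (k m D : ℕ) : ℕ :=
  (D + 1) ^ 2 * (k + (D + 1) * k ^ 3 + 1) + m +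
    (((D + 1) ^ 2 * (k + (D + 1) * k ^ 3 + 1)) ^ 2 + (D + 1) ^ 2) + 2

theorem exists_oracleComplexityLE_boolSum {σ : Type} [Fintype σ] {m s d : ℕ}
    {g : MvPolynomial (σ ⊕ Fin m) K} (hg : ComplexityLE g s) (hd : g.totalDegree ≤ d)
    (hd1 : 1 ≤ d) :
    ∃ n ≤ vertexBound (Fintype.card σ + m + s + 3) m (d + 1),
      OracleComplexityLE (cutEnumerator K n)
        (∑ ε : Fin m → Bool, aeval
          (Sum.elim X (fun j => if ε j then 1 else 0) : σ ⊕ Fin m → MvPolynomial σ K) g) 4 := by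
  classical
  obtain ⟨N, _, w, c, h, S, hN, hh, hS⟩ := exists_grammarSeries_coeff hg hd hd1
  let wt : Interval (d + 1) × ParseState N (d + 1) → K ⊕ (σ ⊕ Fin m) :=
    @rootedWeight N (K ⊕ (σ ⊕ Fin m)) (d + 1) _ ⟨.inl 0⟩ ⟨.inl 1⟩ w (fun m p q => .inl (c m p q)) S
  refine ⟨Fintype.card (ChoiceVertex (Fin m) (Interval (d + 1)) (ParseState N (d + 1))) + 2, ?_, ?_⟩
  · simp only [Fintype.card_sum, Fintype.card_prod, Fintype.card_option, Fintype.card_fin] at hN ⊢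
    have hN' : Fintype.card N ≤ Fintype.card σ + m + s + 3 := hN
    generalize Fintype.card σ + m + s + 3 = k at hN'
    have e : (d + 1 + 1) * (d + 1 + 1) * (Fintype.card N + (d + 1 + 1) *
        (Fintype.card N * (Fintype.card N * Fintype.card N)) + 1) ≤
        (d + 1 + 1) ^ 2 * (k + (d + 1 + 1) * k ^ 3 + 1) := by
      rw [pow_two, show k ^ 3 = k * (k * k) by ring]
      gcongr
    unfold vertexBound
    rw [← pow_two (_ * _ * _), ← pow_two (d + 1 + 1)] at *
    gcongr
  · have : (∑ ε : Fin m → Bool, aeval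
        (Sum.elim X (fun j => if ε j then 1 else 0) : σ ⊕ Fin m → MvPolynomial σ K) g) =
        choiceSum wt parseConflict := by
      unfold choiceSum
      refine Finset.sum_congr rfl fun ε _ => ?_
      rw [← hS, ← sum_rootedWeight hh (Nat.succ_pos d) S]
      simp only [map_sum, map_mul, map_prod]
      refine Finset.sum_congr rfl fun α _ => ?_
      congr 1
      · refine Finset.prod_congr rfl fun J _ => ?_
        rw [← atomVal_rootedWeight, aeval_atomVal]
      · refine Finset.prod_congr rfl fun J _ => Finset.prod_congr rfl fun J' _ => ?_
        split_ifs <;> simp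
    rw [this]
    exact oracleComplexityLE_choiceSum _ _

end Hardness

section PolyBounded

theorem PolyBounded.mono {s t : ℕ → ℕ} (ht : PolyBounded t) (h : ∀ n, s n ≤ t n) :
    PolyBounded s :=
  ht.imp fun _ hp n => (h n).trans (hp n)

theorem PolyBounded.const (c : ℕ) : PolyBounded fun _ => c :=
  ⟨Polynomial.C c, fun n => by simp⟩

theorem PolyBounded.id : PolyBounded fun n => n :=
  ⟨Polynomial.X, fun n => by simp⟩

theorem PolyBounded.add {s t : ℕ → ℕ} (hs : PolyBounded s) (ht : PolyBounded t) :
    PolyBounded fun n => s n + t n := by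
  obtain ⟨p, hp⟩ := hs
  obtain ⟨q, hq⟩ := ht
  exact ⟨p + q, fun n => by simpa using add_le_add (hp n) (hq n)⟩

theorem PolyBounded.mul {s t : ℕ → ℕ} (hs : PolyBounded s) (ht : PolyBounded t) :
    PolyBounded fun n => s n * t n := by
  obtain ⟨p, hp⟩ := hs
  obtain ⟨q, hq⟩ := ht
  exact ⟨p * q, fun n => by simpa using Nat.mul_le_mul (hp n) (hq n)⟩

theorem PolyBounded.pow {s : ℕ → ℕ} (hs : PolyBounded s) (k : ℕ) :
    PolyBounded fun n => s n ^ k := by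
  obtain ⟨p, hp⟩ := hs
  exact ⟨p ^ k, fun n => by simpa using Nat.pow_le_pow_left (hp n) k⟩

theorem polyBounded_vertexBound {k m d : ℕ → ℕ} (hk : PolyBounded k) (hm : PolyBounded m)
    (hd : PolyBounded d) : PolyBounded fun n => vertexBound (k n) (m n) (d n) := by
  have hd1 := hd.add (.const 1)
  have h := (hd1.pow 2).mul ((hk.add (hd1.mul (hk.pow 3))).add (.const 1))
  exact ((h.add hm).add ((h.pow 2).add (hd1.pow 2))).add (.const 2)

end PolyBounded

theorem InVNP.cReduces_cutEnumerator {K : Type*} [CommRing K] {σ : ℕ → Type}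
    [∀ n, Fintype (σ n)] {f : ∀ n, MvPolynomial (σ n) K} (hf : InVNP f) :
    CReduces f fun n => cutEnumerator K n := by
  obtain ⟨⟨hσ, _⟩, m, g, ⟨⟨hcard, hdeg⟩, s, hs, hg⟩, hfg⟩ := hf
  choose p hp hO using fun n => exists_oracleComplexityLE_boolSum (hg n)
    (Nat.le_add_right (g n).totalDegree 1) (Nat.le_add_left 1 _)
  have hm : PolyBounded m := hcard.mono fun n => by simp
  refine ⟨p, (polyBounded_vertexBound (((hσ.add hm).add hs).add (.const 3)) hm
    ((hdeg.add (.const 1)).add (.const 1))).mono hp, fun _ => 4, .const 4, fun n => ?_⟩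
  rw [hfg n]
  exact hO n

section Membership

/-- A polynomial is available as an argument of further gates. -/
def Circuit.Computes {K σ : Type*} [CommSemiring K] {k : ℕ} (D : Circuit K σ k)
    (f : MvPolynomial σ K) : Prop :=
  ∃ o : Operand K σ k, o.val D.values = f

theorem Circuit.computes_C {K σ : Type*} [CommSemiring K] {k : ℕ} (D : Circuit K σ k) (a : K) :
    D.Computes (C a) := ⟨.const a, rfl⟩

theorem Circuit.computes_X {K σ : Type*} [CommSemiring K] {k : ℕ} (D : Circuit K σ k) (i : σ) :
    D.Computes (X i) := ⟨.var i, rfl⟩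

/-- An operand remains available when a gate is appended. -/
def Operand.castSucc {K σ : Type*} {k : ℕ} : Operand K σ k → Operand K σ (k + 1)
  | .const c => .const c
  | .var i => .var i
  | .gate j => .gate j.castSucc

theorem Operand.val_castSucc {K σ : Type*} [CommSemiring K] {k : ℕ}
    (w : Fin k → MvPolynomial σ K) (f : MvPolynomial σ K) (o : Operand K σ k) :
    o.castSucc.val (Fin.snoc (α := fun _ => MvPolynomial σ K) w f) = o.val w := by
  cases o <;> simp [Operand.castSucc, Operand.val]

theorem Circuit.Computes.exists_mul {K σ : Type*} [CommSemiring K] {k : ℕ} {D : Circuit K σ k}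
    {f g : MvPolynomial σ K} (hf : D.Computes f) (hg : D.Computes g) :
    ∃ D' : Circuit K σ (k + 1), D'.Computes (f * g) ∧ ∀ u, D.Computes u → D'.Computes u := by
  obtain ⟨a, rfl⟩ := hf
  obtain ⟨b, rfl⟩ := hg
  refine ⟨.mul D a b, ⟨.gate (Fin.last k), by simp [Operand.val, Circuit.values]⟩, ?_⟩
  rintro u ⟨o, rfl⟩
  exact ⟨o.castSucc, Operand.val_castSucc _ _ _⟩

theorem Circuit.Computes.exists_add {K σ : Type*} [CommSemiring K] {k : ℕ} {D : Circuit K σ k}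
    {f g : MvPolynomial σ K} (hf : D.Computes f) (hg : D.Computes g) :
    ∃ D' : Circuit K σ (k + 1), D'.Computes (f + g) ∧ ∀ u, D.Computes u → D'.Computes u := by
  obtain ⟨a, rfl⟩ := hf
  obtain ⟨b, rfl⟩ := hg
  refine ⟨.add D a b, ⟨.gate (Fin.last k), by simp [Operand.val, Circuit.values]⟩, ?_⟩
  rintro u ⟨o, rfl⟩
  exact ⟨o.castSucc, Operand.val_castSucc _ _ _⟩

variable {K : Type*} [CommRing K] {σ : Type*}

/-- The factor `1 + u (1 - v) (x - 1)`, which is `x` for `u = 1`, `v = 0`, and `1` for other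
Boolean values of `u` and `v`. -/
noncomputable def cutFactor (x u v : σ) : MvPolynomial σ K :=
  C 1 + (X x + C (-1)) * (X u * (C 1 + C (-1) * X v))

theorem Circuit.Computes.exists_mul_cutFactor {k : ℕ} {D : Circuit K σ k}
    {f : MvPolynomial σ K} (hf : D.Computes f) (x u v : σ) :
    ∃ D' : Circuit K σ (k + 7), D'.Computes (cutFactor x u v * f) := by
  obtain ⟨D1, h1, t1⟩ := (D.computes_C (-1)).exists_mul (D.computes_X v)
  obtain ⟨D2, h2, t2⟩ := (D1.computes_C 1).exists_add h1
  obtain ⟨D3, h3, t3⟩ := (D2.computes_X u).exists_mul h2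
  obtain ⟨D4, h4, t4⟩ := (D3.computes_X x).exists_add (D3.computes_C (-1))
  obtain ⟨D5, h5, t5⟩ := h4.exists_mul (t4 _ h3)
  obtain ⟨D6, h6, t6⟩ := (D5.computes_C 1).exists_add h5
  obtain ⟨D7, h7, _⟩ := h6.exists_mul (t6 _ (t5 _ (t4 _ (t3 _ (t2 _ (t1 _ hf))))))
  exact ⟨D7, h7⟩

theorem complexityLE_prod_cutFactor {ι : Type*} (s : Finset ι) (x u v : ι → σ) :
    ComplexityLE (∏ i ∈ s, (cutFactor (x i) (u i) (v i) : MvPolynomial σ K)) (7 * s.card) := by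
  classical
  have : ∃ D : Circuit K σ (7 * s.card),
      D.Computes (∏ i ∈ s, (cutFactor (x i) (u i) (v i) : MvPolynomial σ K)) := by
    induction s using Finset.induction_on with
    | empty => exact ⟨.nil, .const 1, by simp [Operand.val]⟩
    | insert i s hi ih =>
      obtain ⟨D, hD⟩ := ih
      rw [Finset.prod_insert hi, Finset.card_insert_of_notMem hi]
      exact hD.exists_mul_cutFactor _ _ _
  obtain ⟨D, o, ho⟩ := this
  exact ⟨_, le_rfl, D, o, ho⟩

theorem totalDegree_cutFactor_le (x u v : σ) :
    (cutFactor x u v : MvPolynomial σ K).totalDegree ≤ 3 := by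
  have hX : ∀ i : σ, (X i : MvPolynomial σ K).totalDegree ≤ 1 := fun i =>
    (totalDegree_monomial_le _ _).trans (by simp)
  have h1 : (X x + C (-1) : MvPolynomial σ K).totalDegree ≤ 1 :=
    (totalDegree_add _ _).trans (max_le (hX x) (by simp))
  have h2 : (C 1 + C (-1) * X v : MvPolynomial σ K).totalDegree ≤ 1 := by
    refine (totalDegree_add _ _).trans (max_le (by simp) ?_)
    refine (totalDegree_mul _ _).trans ?_
    have := hX v
    rw [totalDegree_C]; omega
  refine (totalDegree_add _ _).trans (max_le (by simp) ?_)
  refine (totalDegree_mul _ _).trans ?_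
  have h3 := totalDegree_mul (X u : MvPolynomial σ K) (C 1 + C (-1) * X v)
  have := hX u
  omega

theorem cutEnumerator_eq_sum_bool (n : ℕ) :
    cutEnumerator K n = ∑ ε : Fin n → Bool, aeval
      (Sum.elim X (fun j => if ε j then 1 else 0) :
        (Fin n × Fin n) ⊕ Fin n → MvPolynomial (Fin n × Fin n) K)
      (∏ p : Fin n × Fin n, (cutFactor (.inl p) (.inr p.1) (.inr p.2) :
        MvPolynomial ((Fin n × Fin n) ⊕ Fin n) K)) := by
  have h := aeval_cutEnumerator (K := K) n (fun p => (X p : MvPolynomial (Fin n × Fin n) K))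
  rw [aeval_X_left_apply] at h
  rw [h, cutSum]
  refine Finset.sum_congr rfl fun ε _ => ?_
  rw [map_prod, Fintype.prod_prod_type]
  refine Finset.prod_congr rfl fun i _ => Finset.prod_congr rfl fun j _ => ?_
  cases hi : ε i <;> cases hj : ε j <;> simp [cutFactor, hi, hj]

theorem inVNP_cutEnumerator (K : Type*) [CommRing K] :
    InVNP (σ := fun n => Fin n × Fin n) fun n => cutEnumerator K n := by
  have hsq : PolyBounded fun n => n * n := PolyBounded.id.mul .id
  refine ⟨⟨hsq.mono fun n => by simp, hsq.mono fun n => ?_⟩, fun n => n,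
    fun n => ∏ p : Fin n × Fin n, cutFactor (.inl p) (.inr p.1) (.inr p.2),
    ⟨⟨(hsq.add .id).mono fun n => by simp, ((PolyBounded.const 3).mul hsq).mono fun n => ?_⟩,
      fun n => 7 * (n * n), (PolyBounded.const 7).mul hsq, fun n => ?_⟩,
    fun n => cutEnumerator_eq_sum_bool n⟩
  · refine totalDegree_finsetSum_le fun V _ => ?_
    refine (totalDegree_finsetProd _ _).trans ?_
    refine (Finset.sum_le_card_nsmul _ _ n fun v _ => ?_).trans ?_
    · refine (totalDegree_finsetProd _ _).trans ?_
      refine (Finset.sum_le_card_nsmul _ _ 1 fun v' _ =>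
        (totalDegree_monomial_le _ _).trans (by simp)).trans ?_
      simpa using (Finset.card_le_univ Vᶜ)
    · rw [smul_eq_mul]
      exact Nat.mul_le_mul_right _ (by simpa using Finset.card_le_univ V)
  · refine (totalDegree_finsetProd _ _).trans ?_
    refine (Finset.sum_le_card_nsmul _ _ 3 fun p _ => totalDegree_cutFactor_le _ _ _).trans ?_
    simp [mul_comm]
  · simpa using complexityLE_prod_cutFactor (K := K) (Finset.univ : Finset (Fin n × Fin n))
      (Sum.inl : _ → (Fin n × Fin n) ⊕ Fin n) (fun p => .inr p.1) fun p => .inr p.2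

end Membership

end Valiant

theorem mainTheorem2 :
    Valiant.IsVNPComplete (τ := fun n => Fin n × Fin n) (fun n => Valiant.cutEnumerator ℚ n) := by
  exact ⟨Valiant.inVNP_cutEnumerator ℚ, fun _ _ _ hf => hf.cReduces_cutEnumerator⟩
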